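/- Terminology. All theories are theories in classical first-order predicate calculus with equality, over a vocabulary of effectively given function and predicate symbols; a theory is given by a set of sentences (its axioms), and $T\vdash A$ means that $A$ has a formal derivation from the axioms of $T$. Formulas and terms are strings over the alphabet consisting of the symbols of the vocabulary and the logical signs. A theory is *axiomatised* if its set of axioms is recursively enumerable; it is *consistent* if no sentence $S$ satisfies both $T\vdash S$ and $T\vdash\neg S$, and *complete* if for every sentence $S$, $T\vdash S$ or $T\vdash\neg S$. An axiomatised theory that is consistent and complete is called *decidable*. *Number theory* $\mathbb N$ is first-order Peano arithmetic in the vocabulary $0,s,+,\cdot$. A theory $M$ is *meta to* a theory $\mathrm{Th}$ if every string over the alphabet of $\mathrm{Th}$ is (effectively, and with different strings being different terms) a closed term of $M$. For such an $M$, a predicate $\mathrm{Prov}(x)$ of $M$ (a formula with at most the variable $x$ free) *correctly expresses provability* for $\mathrm{Th}$ if for all sentences $S$ of $\mathrm{Th}$, $$M\vdash \mathrm{Prov}(S)\iff \mathrm{Th}\vdash S .$$ *Gödel's assumption* is the statement: there exists a decidable theory $\mathrm{META}$ that is meta to $\mathbb N$ and contains a predicate $\mathrm{Prov}$ that correctly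 expresses provability for $\mathbb N$. **Corollary.** Either Gödel's assumption, or the statement that number theory $\mathbb N$ is decidable (that is, consistent and complete), is false: the two cannot both hold. -/

import Mathlib

/-! # First-order theories as systems of strings -/

/-- An effectively presented first-order vocabulary: function symbols (constants are the function
symbols of arity `0`) and predicate symbols, each coming with a computable arity. Equality, the
connectives and the quantifier are logical signs. -/
structure Vocabulary where
  Fun : Type
  Rel : Type
  funArity : Fun → ℕ
  relArity : Rel → ℕ
  primcodableFun : Primcodable Fun
  primcodableRel : Primcodable Rel
  computable_funArity : Computable funArity
  computable_relArity : Computable relArity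

attribute [instance] Vocabulary.primcodableFun Vocabulary.primcodableRel

/-- Terms; variables are numbered, and inside formulas the numbers are de Bruijn indices. -/
inductive Term (V : Vocabulary) : Type
  | var (n : ℕ) : Term V
  | app (f : V.Fun) (ts : Fin (V.funArity f) → Term V) : Term V

/-- Formulas, with negation, disjunction and existential quantification as primitives. In `ex A`
the bound variable is the variable `0` of `A`, and the variable `n + 1` of `A` is the variable `n`
of `ex A`. -/
inductive Formula (V : Vocabulary) : Type
  | eq (t u : Term V) : Formula V
  | rel (R : V.Rel) (ts : Fin (V.relArity R) → Term V) : Formula V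
  | neg (A : Formula V) : Formula V
  | or (A B : Formula V) : Formula V
  | ex (A : Formula V) : Formula V

namespace Term

/-- Simultaneous substitution of `σ n` for every variable `n`. -/
def subst {V : Vocabulary} (σ : ℕ → Term V) : Term V → Term V
  | var n => σ n
  | app f ts => app f (fun i => (ts i).subst σ)

/-- All variables of the term are smaller than `k`. -/
def Below {V : Vocabulary} (k : ℕ) : Term V → Prop
  | var n => n < k
  | app _ ts => ∀ i, (ts i).Below k

/-- A closed term: no variables. -/
def IsClosed {V : Vocabulary} (t : Term V) : Prop := t.Below 0

/-- The substitution `0 ↦ t`, `n + 1 ↦ n`. -/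
def single {V : Vocabulary} (t : Term V) : ℕ → Term V
  | 0 => t
  | n + 1 => var n

/-- The substitution that `σ` induces under a quantifier. -/
def up {V : Vocabulary} (σ : ℕ → Term V) : ℕ → Term V
  | 0 => var 0
  | n + 1 => (σ n).subst (fun m => var (m + 1))

end Term

namespace Formula

/-- Simultaneous, capture-avoiding substitution of `σ n` for every free variable `n`. -/
def subst {V : Vocabulary} : Formula V → (ℕ → Term V) → Formula V
  | eq t u, σ => eq (t.subst σ) (u.subst σ)
  | rel R ts, σ => rel R (fun i => (ts i).subst σ)
  | neg A, σ => neg (A.subst σ)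
  | or A B, σ => or (A.subst σ) (B.subst σ)
  | ex A, σ => ex (A.subst (Term.up σ))

/-- All free variables of the formula are smaller than `k`. -/
def Below {V : Vocabulary} : ℕ → Formula V → Prop
  | k, eq t u => t.Below k ∧ u.Below k
  | k, rel _ ts => ∀ i, (ts i).Below k
  | k, neg A => A.Below k
  | k, or A B => A.Below k ∧ B.Below k
  | k, ex A => A.Below (k + 1)

/-- A sentence: no free variables. -/
def IsSentence {V : Vocabulary} (A : Formula V) : Prop := A.Below 0

/-- A (unary) predicate: at most the variable `0` is free. -/
def IsPredicate {V : Vocabulary} (A : Formula V) : Prop := A.Below 1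

/-- `A.inst t` is `A(t)`: the term `t` replaces the variable `0`, which is removed. -/
def inst {V : Vocabulary} (A : Formula V) (t : Term V) : Formula V := A.subst (Term.single t)

/-- `A.lift` is `A` with every free variable `n` renamed to `n + 1`; the variable `0` is not free
in it. -/
def lift {V : Vocabulary} (A : Formula V) : Formula V := A.subst (fun n => Term.var (n + 1))

def imp {V : Vocabulary} (A B : Formula V) : Formula V := or (neg A) B

def and {V : Vocabulary} (A B : Formula V) : Formula V := neg (or (neg A) (neg B))

def all {V : Vocabulary} (A : Formula V) : Formula V := neg (ex (neg A))

/-- `A.closure k` is `A` preceded by `k` universal quantifiers. -/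
def closure {V : Vocabulary} (A : Formula V) : ℕ → Formula V
  | 0 => A
  | k + 1 => (all A).closure k

end Formula

/-! ## Strings -/

/-- The logical signs: `=`, `¬`, `∨`, `∃`, the letter `v` for variables, and the stroke that
numbers them. -/
inductive Sign : Type
  | eq | neg | or | ex | var | stroke

/-- The logical signs numbered by `0, …, 5`. -/
def Sign.equivFin : Sign ≃ Fin 6 where
  toFun
    | eq => 0
    | neg => 1
    | or => 2
    | ex => 3
    | var => 4
    | stroke => 5
  invFun := ![eq, neg, or, ex, var, stroke]
  left_inv s := by cases s <;> rfl
  right_inv i := by fin_cases i <;> rfl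

instance : Primcodable Sign := Primcodable.ofEquiv (Fin 6) Sign.equivFin

/-- The alphabet of a vocabulary: its symbols and the logical signs. -/
abbrev Letter (V : Vocabulary) : Type := V.Fun ⊕ V.Rel ⊕ Sign

/-- A logical sign as a letter. -/
def Sign.letter {V : Vocabulary} (s : Sign) : Letter V := Sum.inr (Sum.inr s)

/-- The string of a term, in Polish notation; the variable `n` is `v` followed by `n` strokes. -/
def Term.str {V : Vocabulary} : Term V → List (Letter V)
  | .var n => Sign.var.letter :: List.replicate n Sign.stroke.letter
  | .app f ts => Sum.inl f :: (List.ofFn fun i => (ts i).str).flatten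

/-- The string of a formula, in Polish notation. -/
def Formula.str {V : Vocabulary} : Formula V → List (Letter V)
  | .eq t u => Sign.eq.letter :: (t.str ++ u.str)
  | .rel R ts => Sum.inr (Sum.inl R) :: (List.ofFn fun i => (ts i).str).flatten
  | .neg A => Sign.neg.letter :: A.str
  | .or A B => Sign.or.letter :: (A.str ++ B.str)
  | .ex A => Sign.ex.letter :: A.str

/-! ## Theories and provability -/

/-- A first-order theory: a vocabulary and a set of sentences, its nonlogical axioms. -/
structure FirstOrderTheory where
  voc : Vocabulary
  axioms : Set (Formula voc)
  isSentence_of_mem : ∀ A ∈ axioms, A.IsSentence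

namespace FirstOrderTheory

/-- `Th.Proves A`: the formula `A` has a derivation from the axioms of `Th` in the (Hilbert-style)
classical predicate calculus with equality, in the formulation based on `¬`, `∨`, `∃`. -/
inductive Proves (Th : FirstOrderTheory) : Formula Th.voc → Prop
  | ax {A : Formula Th.voc} : A ∈ Th.axioms → Proves Th A
  | excludedMiddle (A : Formula Th.voc) : Proves Th (.or (.neg A) A)
  | substitution (A : Formula Th.voc) (t : Term Th.voc) : Proves Th (.imp (A.inst t) (.ex A))
  | identity (t : Term Th.voc) : Proves Th (.eq t t)
  | equality (A : Formula Th.voc) (t u : Term Th.voc) : Proves Th (.imp (.eq t u) (.imp (A.inst t) (A.inst u)))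
  | expansion {A : Formula Th.voc} (B : Formula Th.voc) : Proves Th A → Proves Th (.or B A)
  | contraction {A : Formula Th.voc} : Proves Th (.or A A) → Proves Th A
  | associativity {A B C : Formula Th.voc} :
      Proves Th (.or A (.or B C)) → Proves Th (.or (.or A B) C)
  | cut {A B C : Formula Th.voc} :
      Proves Th (.or A B) → Proves Th (.or (.neg A) C) → Proves Th (.or B C)
  | exIntro {A B : Formula Th.voc} : Proves Th (.imp A B.lift) → Proves Th (.imp (.ex A) B)

/-- No sentence is provable together with its negation. -/
def Consistent (Th : FirstOrderTheory) : Prop :=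
  ∀ S : Formula Th.voc, S.IsSentence → ¬ (Th.Proves S ∧ Th.Proves (.neg S))

/-- Every sentence is provable or refutable. -/
def Complete (Th : FirstOrderTheory) : Prop :=
  ∀ S : Formula Th.voc, S.IsSentence → Th.Proves S ∨ Th.Proves (.neg S)

/-- A theory is axiomatised (formal) if the strings that are axioms can be effectively listed. -/
def Axiomatised (Th : FirstOrderTheory) : Prop :=
  REPred fun s : List (Letter Th.voc) => ∃ A ∈ Th.axioms, A.str = s

/-- A theory decides its sentences if it is consistent and complete. (For an axiomatised theory it
follows that provability is algorithmically decidable.) -/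
def DecidesSentences (Th : FirstOrderTheory) : Prop :=
  Th.Consistent ∧ Th.Complete

/-- `M` is meta to `Th` through `quote`: every string over the alphabet of `Th`, well-formed in
`Th` or not, is a closed term of `M`. Different strings are different terms, and it can be computed
which term a string is. -/
structure IsMetaTo (M Th : FirstOrderTheory) (quote : List (Letter Th.voc) → Term M.voc) :
    Prop where
  isClosed : ∀ s, (quote s).IsClosed
  injective : Function.Injective quote
  computable : Computable fun s => (quote s).str

/-- The predicate `Prov` of `M` correctly expresses provability for `Th`: `M` proves `Prov(S)` if
`Th` proves `S`, and `M` does not prove `Prov(S)` if `Th` does not prove `S`, for every sentence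
`S` of `Th`. -/
def ExpressesProvability (M Th : FirstOrderTheory) (quote : List (Letter Th.voc) → Term M.voc)
    (Prov : Formula M.voc) : Prop :=
  Prov.IsPredicate ∧
    ∀ S : Formula Th.voc, S.IsSentence → (M.Proves (Prov.inst (quote S.str)) ↔ Th.Proves S)

/-- Gödel's assumption for the theory `Th`: there is an axiomatised, consistent and complete theory
`META` that is meta to `Th` and has a predicate `Prov` that correctly expresses provability
for `Th`. -/
def GoedelAssumption (Th : FirstOrderTheory) : Prop :=
  ∃ META : FirstOrderTheory, META.Axiomatised ∧ META.DecidesSentences ∧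
    ∃ quote : List (Letter Th.voc) → Term META.voc, META.IsMetaTo Th quote ∧
      ∃ Prov : Formula META.voc, META.ExpressesProvability Th quote Prov

end FirstOrderTheory

/-! ## Number theory -/

/-- The function symbols of arithmetic. -/
inductive ArithFun : Type
  | zero | succ | add | mul

/-- The function symbols of arithmetic numbered by `0, …, 3`. -/
def ArithFun.equivFin : ArithFun ≃ Fin 4 where
  toFun
    | zero => 0
    | succ => 1
    | add => 2
    | mul => 3
  invFun := ![zero, succ, add, mul]
  left_inv s := by cases s <;> rfl
  right_inv i := by fin_cases i <;> rfl

instance : Primcodable ArithFun := Primcodable.ofEquiv (Fin 4) ArithFun.equivFin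

instance : Finite ArithFun := Finite.of_equiv (Fin 4) ArithFun.equivFin.symm

abbrev ArithFun.arity : ArithFun → ℕ
  | zero => 0
  | succ => 1
  | add => 2
  | mul => 2

/-- The vocabulary `0, s, +, ·` of arithmetic. -/
abbrev arithmetic : Vocabulary where
  Fun := ArithFun
  Rel := Empty
  funArity := ArithFun.arity
  relArity := Empty.elim
  primcodableFun := inferInstance
  primcodableRel := inferInstance
  computable_funArity := (Primrec.dom_finite _).to_comp
  computable_relArity := (Primrec.dom_finite _).to_comp

namespace Arith

def zero : Term arithmetic := .app (V := arithmetic) ArithFun.zero ![]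

def succ (t : Term arithmetic) : Term arithmetic := .app (V := arithmetic) ArithFun.succ ![t]

def add (t u : Term arithmetic) : Term arithmetic := .app (V := arithmetic) ArithFun.add ![t, u]

def mul (t u : Term arithmetic) : Term arithmetic := .app (V := arithmetic) ArithFun.mul ![t, u]

/-- `A(s(x))` for `A = A(x)`, where `x` is the variable `0`. -/
def atSucc (A : Formula arithmetic) : Formula arithmetic :=
  A.subst fun
    | 0 => succ (.var 0)
    | n + 1 => .var (n + 1)

/-- `A(0) ∧ ∀ x (A(x) → A(s(x))) → ∀ x A(x)`, where `x` is the variable `0` of `A`. -/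
def induction (A : Formula arithmetic) : Formula arithmetic :=
  .imp (.and (A.inst zero) (.all (.imp A (atSucc A)))) (.all A)

/-- The first-order Peano axioms. -/
inductive IsPeanoAxiom : Formula arithmetic → Prop
  | succ_ne_zero : IsPeanoAxiom (.all (.neg (.eq (succ (.var 0)) zero)))
  | succ_inj : IsPeanoAxiom
      (.all (.all (.imp (.eq (succ (.var 1)) (succ (.var 0))) (.eq (.var 1) (.var 0)))))
  | add_zero : IsPeanoAxiom (.all (.eq (add (.var 0) zero) (.var 0)))
  | add_succ : IsPeanoAxiom
      (.all (.all (.eq (add (.var 1) (succ (.var 0))) (succ (add (.var 1) (.var 0))))))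
  | mul_zero : IsPeanoAxiom (.all (.eq (mul (.var 0) zero) zero))
  | mul_succ : IsPeanoAxiom
      (.all (.all (.eq (mul (.var 1) (succ (.var 0))) (add (mul (.var 1) (.var 0)) (.var 1)))))
  | induction (k : ℕ) (A : Formula arithmetic) (hA : A.Below (k + 1)) :
      IsPeanoAxiom ((induction A).closure k)

end Arith

/-! The Peano axioms are sentences. -/

theorem Term.Below.subst {V : Vocabulary} {m n : ℕ} {σ : ℕ → Term V}
    (hσ : ∀ i < m, (σ i).Below n) : ∀ {t : Term V}, t.Below m → (t.subst σ).Below n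
  | .var i, h => hσ i h
  | .app _ _, h => fun i => Term.Below.subst hσ (h i)

theorem Formula.Below.subst {V : Vocabulary} {A : Formula V} : ∀ {m n : ℕ} {σ : ℕ → Term V},
    (∀ i < m, (σ i).Below n) → A.Below m → (A.subst σ).Below n := by
  induction A with
  | eq t u => exact fun hσ h => ⟨h.1.subst hσ, h.2.subst hσ⟩
  | rel R ts => exact fun hσ h i => (h i).subst hσ
  | neg A ih => exact fun hσ h => ih hσ h
  | or A B ihA ihB => exact fun hσ h => ⟨ihA hσ h.1, ihB hσ h.2⟩
  | ex A ih =>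
    intro m n σ hσ h
    refine ih (m := m + 1) ?_ h
    intro i hi
    cases i with
    | zero => exact Nat.succ_pos n
    | succ i =>
      refine Term.Below.subst (m := n) ?_ (hσ i (by omega))
      intro j hj
      exact Nat.succ_lt_succ hj

theorem Formula.Below.closure {V : Vocabulary} {k : ℕ} : ∀ {A : Formula V}, A.Below k →
    (A.closure k).IsSentence := by
  induction k with
  | zero => exact fun h => h
  | succ k ih => exact fun h => ih h

theorem Arith.below_zero {k : ℕ} : Arith.zero.Below k := fun i => Fin.elim0 i

theorem Arith.below_succ {k : ℕ} {t : Term arithmetic} :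
    (Arith.succ t).Below k ↔ t.Below k :=
  Fin.forall_fin_one (p := fun i => (![t] i).Below k)

theorem Arith.below_add {k : ℕ} {t u : Term arithmetic} :
    (Arith.add t u).Below k ↔ t.Below k ∧ u.Below k :=
  Fin.forall_fin_two (p := fun i => (![t, u] i).Below k)

theorem Arith.below_mul {k : ℕ} {t u : Term arithmetic} :
    (Arith.mul t u).Below k ↔ t.Below k ∧ u.Below k :=
  Fin.forall_fin_two (p := fun i => (![t, u] i).Below k)

theorem Arith.IsPeanoAxiom.isSentence {A : Formula arithmetic} (h : IsPeanoAxiom A) :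
    A.IsSentence := by
  cases h with
  | induction k A hA =>
    refine Formula.Below.closure ⟨⟨?_, ⟨hA, ?_⟩⟩, hA⟩
    · refine Formula.Below.subst (m := k + 1) ?_ hA
      intro i hi
      cases i with
      | zero => exact fun i => Fin.elim0 i
      | succ i => exact Nat.lt_of_succ_lt_succ hi
    · refine Formula.Below.subst (m := k + 1) ?_ hA
      intro i hi
      cases i with
      | zero => exact Arith.below_succ.2 (Nat.succ_pos k)
      | succ i => exact hi
  | _ =>
    simp [Formula.IsSentence, Formula.all, Formula.imp, Formula.Below, Term.Below, below_zero,
      below_succ, below_add, below_mul]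

/-- Number theory: first-order Peano arithmetic. -/
abbrev numberTheory : FirstOrderTheory where
  voc := arithmetic
  axioms := {A | Arith.IsPeanoAxiom A}
  isSentence_of_mem := fun _ h => h.isSentence

/-!
Number theory is not complete, by Gödel's first incompleteness theorem in its semantic form; so
number theory is not decidable, and the two statements cannot hold together.

Everything takes place in the standard model `ℕ`. Call a predicate arithmetical if a formula defines
it there. If the set `IsTheoremCode` is arithmetical, consists of codes of true formulas, and
contains the codes of all theorems of number theory, then the diagonal lemma
(`Arith.exists_diagonal_sentence`) gives a sentence `A` that is true if and only if its code is
outside that set. By soundness `A` is true and its code is outside the set, so number theory proves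
neither `A` nor, since the theorems are true, `¬ A`.

The point is that `IsTheoremCode` is arithmetical. All syntactic notions (codes of terms and
formulas, substitution, numerals, derivability) are written as inductively generated sets of
numbers whose clauses have at most two premises, and `Generated.arithmetical` shows once and for all
that such a set is arithmetical if its clauses are: a generation is a finite sequence, and those are
coded by Gödel's beta function. There is no need to represent anything inside number theory, since
definability in `ℕ` suffices.

Since only truth of the theorems matters, `IsTheoremCode` may be larger than the set of theorems: it
is generated with unrestricted induction axioms and with universal generalization as a rule, which
spares the arithmetization of universal closures. For the substitutions, one relation is enough,
because instantiation, the renaming that prepares a quantifier rule, the substitution of `s(x)` for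
`x`, and the raising of variables below quantifiers are all of the form `Term.consShift`.
-/

/-! ### Truth in the standard model -/

/-- The assignment that gives the variable `0` the value `x` and the variable `n + 1` the value
`v n`. -/
def consVal (x : ℕ) (v : ℕ → ℕ) : ℕ → ℕ
  | 0 => x
  | n + 1 => v n

/-- The value of an arithmetical term in the standard model. -/
def Term.val (v : ℕ → ℕ) : Term arithmetic → ℕ
  | .var n => v n
  | .app ArithFun.zero _ => 0
  | .app ArithFun.succ ts => (ts 0).val v + 1
  | .app ArithFun.add ts => (ts 0).val v + (ts 1).val v
  | .app ArithFun.mul ts => (ts 0).val v * (ts 1).val v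

/-- Truth of an arithmetical formula in the standard model, under an assignment. -/
def Formula.Holds : Formula arithmetic → (ℕ → ℕ) → Prop
  | .eq t u, v => t.val v = u.val v
  | .rel R _, _ => R.elim
  | .neg A, v => ¬ A.Holds v
  | .or A B, v => A.Holds v ∨ B.Holds v
  | .ex A, v => ∃ x, A.Holds (consVal x v)

namespace Arith

theorem term_induction {p : Term arithmetic → Prop} (var : ∀ n, p (.var n)) (zero : p zero)
    (succ : ∀ t, p t → p (succ t)) (add : ∀ t u, p t → p u → p (add t u))
    (mul : ∀ t u, p t → p u → p (mul t u)) (t : Term arithmetic) : p t := by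
  induction t with
  | var n => exact var n
  | app f ts ih =>
    cases f with
    | zero => rw [show ts = ![] from funext fun i => i.elim0]; exact zero
    | succ =>
      rw [show ts = ![ts 0] from funext fun i => by fin_cases i; rfl]
      exact succ _ (ih 0)
    | add =>
      rw [show ts = ![ts 0, ts 1] from funext fun i => by fin_cases i <;> rfl]
      exact add _ _ (ih 0) (ih 1)
    | mul =>
      rw [show ts = ![ts 0, ts 1] from funext fun i => by fin_cases i <;> rfl]
      exact mul _ _ (ih 0) (ih 1)

theorem subst_zero (σ : ℕ → Term arithmetic) : zero.subst σ = zero :=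
  congrArg (Term.app (V := arithmetic) ArithFun.zero) (funext fun i => i.elim0)

theorem subst_succ (σ : ℕ → Term arithmetic) (t : Term arithmetic) :
    (succ t).subst σ = succ (t.subst σ) :=
  congrArg (Term.app (V := arithmetic) ArithFun.succ)
    (funext fun i => by fin_cases i; rfl)

theorem subst_add (σ : ℕ → Term arithmetic) (t u : Term arithmetic) :
    (add t u).subst σ = add (t.subst σ) (u.subst σ) :=
  congrArg (Term.app (V := arithmetic) ArithFun.add)
    (funext fun i => by fin_cases i <;> rfl)

theorem subst_mul (σ : ℕ → Term arithmetic) (t u : Term arithmetic) :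
    (mul t u).subst σ = mul (t.subst σ) (u.subst σ) :=
  congrArg (Term.app (V := arithmetic) ArithFun.mul)
    (funext fun i => by fin_cases i <;> rfl)

@[simp] theorem val_var (v : ℕ → ℕ) (n : ℕ) :
    Term.val v (.var n : Term arithmetic) = v n := rfl

@[simp] theorem val_zero (v : ℕ → ℕ) : zero.val v = 0 := rfl

@[simp] theorem val_succ (v : ℕ → ℕ) (t : Term arithmetic) : (succ t).val v = t.val v + 1 := rfl

@[simp] theorem val_add (v : ℕ → ℕ) (t u : Term arithmetic) :
    (add t u).val v = t.val v + u.val v := rfl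

@[simp] theorem val_mul (v : ℕ → ℕ) (t u : Term arithmetic) :
    (mul t u).val v = t.val v * u.val v := rfl

theorem val_subst (v : ℕ → ℕ) (σ : ℕ → Term arithmetic) (t : Term arithmetic) :
    (t.subst σ).val v = t.val fun n => (σ n).val v := by
  induction t using term_induction with
  | var n => rfl
  | zero => rw [subst_zero]; rfl
  | succ t ih => simp [subst_succ, ih]
  | add t u iht ihu => simp [subst_add, iht, ihu]
  | mul t u iht ihu => simp [subst_mul, iht, ihu]

theorem val_up (x : ℕ) (v : ℕ → ℕ) (σ : ℕ → Term arithmetic) :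
    (fun n => (Term.up σ n).val (consVal x v)) = consVal x fun n => (σ n).val v := by
  funext n
  cases n with
  | zero => rfl
  | succ n => exact val_subst _ _ _

theorem holds_subst (A : Formula arithmetic) : ∀ (v : ℕ → ℕ) (σ : ℕ → Term arithmetic),
    (A.subst σ).Holds v ↔ A.Holds fun n => (σ n).val v := by
  induction A with
  | eq t u => intro v σ; simp [Formula.subst, Formula.Holds, val_subst]
  | rel R ts => exact R.elim
  | neg A ih => intro v σ; simp [Formula.subst, Formula.Holds, ih]
  | or A B ihA ihB => intro v σ; simp [Formula.subst, Formula.Holds, ihA, ihB]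
  | ex A ih => intro v σ; simp [Formula.subst, Formula.Holds, ih, val_up]

theorem holds_inst (A : Formula arithmetic) (t : Term arithmetic) (v : ℕ → ℕ) :
    (A.inst t).Holds v ↔ A.Holds (consVal (t.val v) v) := by
  rw [Formula.inst, holds_subst]
  exact iff_of_eq (congrArg A.Holds (funext fun n => by cases n <;> rfl))

theorem holds_lift (A : Formula arithmetic) (x : ℕ) (v : ℕ → ℕ) :
    A.lift.Holds (consVal x v) ↔ A.Holds v := by
  rw [Formula.lift, holds_subst]
  rfl

theorem holds_atSucc (A : Formula arithmetic) (x : ℕ) (v : ℕ → ℕ) :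
    (atSucc A).Holds (consVal x v) ↔ A.Holds (consVal (x + 1) v) := by
  rw [atSucc, holds_subst]
  exact iff_of_eq (congrArg A.Holds (funext fun n => by cases n <;> rfl))

theorem holds_imp {A B : Formula arithmetic} {v : ℕ → ℕ} :
    (A.imp B).Holds v ↔ (A.Holds v → B.Holds v) := by
  simp [Formula.imp, Formula.Holds, imp_iff_not_or]

theorem holds_and {A B : Formula arithmetic} {v : ℕ → ℕ} :
    (A.and B).Holds v ↔ (A.Holds v ∧ B.Holds v) := by
  simp [Formula.and, Formula.Holds]

theorem holds_all {A : Formula arithmetic} {v : ℕ → ℕ} :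
    A.all.Holds v ↔ ∀ x, A.Holds (consVal x v) := by
  simp [Formula.all, Formula.Holds]

theorem holds_induction (A : Formula arithmetic) (v : ℕ → ℕ) : (induction A).Holds v := by
  simp only [induction, holds_imp, holds_and, holds_all, holds_inst, holds_atSucc]
  rintro ⟨h0, hs⟩ x
  induction x with
  | zero => exact h0
  | succ x ih => exact hs x ih

end Arith

/-! ### Arithmetical predicates and functions -/

/-- A predicate of assignments is arithmetical if a formula of arithmetic defines it in the
standard model. -/
def Arithmetical (P : (ℕ → ℕ) → Prop) : Prop :=
  ∃ A : Formula arithmetic, ∀ v, A.Holds v ↔ P v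

/-- A function of assignments is arithmetical if its graph is; the value is the variable `0` and
the variables of the argument are shifted by one. This is a structure so that the rules for
predicates do not apply to the graph by unfolding. -/
structure ArithmeticalFun (f : (ℕ → ℕ) → ℕ) : Prop where
  graph : Arithmetical fun v => v 0 = f fun n => v (n + 1)

/-- An arithmetical set of natural numbers. -/
def ArithmeticalSet (S : ℕ → Prop) : Prop := Arithmetical fun v => S (v 0)

namespace Arithmetical

variable {P Q : (ℕ → ℕ) → Prop} {f g h : (ℕ → ℕ) → ℕ}

theorem congr (hP : Arithmetical P) (h : ∀ v, Q v ↔ P v) : Arithmetical Q :=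
  hP.imp fun _ hA v => (hA v).trans (h v).symm

theorem not (hP : Arithmetical P) : Arithmetical fun v => ¬ P v :=
  hP.elim fun A hA => ⟨.neg A, fun v => not_congr (hA v)⟩

theorem or (hP : Arithmetical P) (hQ : Arithmetical Q) : Arithmetical fun v => P v ∨ Q v :=
  hP.elim fun A hA => hQ.elim fun B hB => ⟨.or A B, fun v => or_congr (hA v) (hB v)⟩

theorem and (hP : Arithmetical P) (hQ : Arithmetical Q) : Arithmetical fun v => P v ∧ Q v :=
  (hP.not.or hQ.not).not.congr fun _ => by tauto

theorem imp (hP : Arithmetical P) (hQ : Arithmetical Q) : Arithmetical fun v => P v → Q v :=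
  (hP.not.or hQ).congr fun _ => imp_iff_not_or

/-- As for formulas, the quantified variable is `0` and the others are shifted by one. -/
theorem ex {P : (ℕ → ℕ) → ℕ → Prop} (hP : Arithmetical fun v => P (fun n => v (n + 1)) (v 0)) :
    Arithmetical fun v => ∃ x, P v x :=
  hP.elim fun A hA => ⟨.ex A, fun v => exists_congr fun x => hA (consVal x v)⟩

theorem all {P : (ℕ → ℕ) → ℕ → Prop} (hP : Arithmetical fun v => P (fun n => v (n + 1)) (v 0)) :
    Arithmetical fun v => ∀ x, P v x :=
  (ex (P := fun v x => ¬ P v x) hP.not).not.congr fun _ => by simp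

/-- Variables may be renamed. -/
theorem rename (hP : Arithmetical P) (ρ : ℕ → ℕ) : Arithmetical fun v => P fun n => v (ρ n) :=
  hP.elim fun A hA => ⟨A.subst fun n => .var (ρ n), fun _ => (Arith.holds_subst _ _ _).trans (hA _)⟩

/-- The value of an arithmetical function may be substituted for a variable of an arithmetical
predicate: `P (f v)` is equivalent to `∃ x, x = f v ∧ P x`. -/
theorem bind {P : (ℕ → ℕ) → ℕ → Prop} (hf : ArithmeticalFun f)
    (hP : Arithmetical fun v => P (fun n => v (n + 1)) (v 0)) : Arithmetical fun v => P v (f v) :=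
  (ex (P := fun v x => x = f v ∧ P v x) (and hf.graph hP)).congr fun _ => by simp

theorem term_eq (t u : Term arithmetic) : Arithmetical fun v => t.val v = u.val v :=
  ⟨.eq t u, fun _ => Iff.rfl⟩

end Arithmetical

namespace ArithmeticalFun

variable {f g : (ℕ → ℕ) → ℕ}

theorem shift (hf : ArithmeticalFun f) : ArithmeticalFun fun v => f fun n => v (n + 1) :=
  ⟨hf.graph.rename fun | 0 => 0 | n + 1 => n + 2⟩

/-- Composition with a binary function, whose graph is given in the variables `0`, `1`, `2`. -/
theorem bind₂ {F : ℕ → ℕ → ℕ} (hF : Arithmetical fun v => v 0 = F (v 1) (v 2))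
    (hf : ArithmeticalFun f) (hg : ArithmeticalFun g) :
    ArithmeticalFun fun v => F (f v) (g v) :=
  ⟨Arithmetical.bind (P := fun v y => v 0 = F y (g fun n => v (n + 1))) hf.shift
    (Arithmetical.bind (P := fun v z => v 1 = F (v 0) z) hg.shift.shift
      (hF.rename fun | 0 => 2 | 1 => 1 | 2 => 0 | n => n))⟩

theorem var (i : ℕ) : ArithmeticalFun fun v => v i :=
  ⟨Arithmetical.term_eq (.var 0) (.var (i + 1))⟩

theorem const (c : ℕ) : ArithmeticalFun fun _ => c := by
  induction c with
  | zero => exact ⟨Arithmetical.term_eq (.var 0) Arith.zero⟩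
  | succ c ih =>
    exact bind₂ (F := fun x _ => x + 1) (Arithmetical.term_eq (.var 0) (Arith.succ (.var 1))) ih ih

theorem add (hf : ArithmeticalFun f) (hg : ArithmeticalFun g) :
    ArithmeticalFun fun v => f v + g v :=
  bind₂ (Arithmetical.term_eq (.var 0) (Arith.add (.var 1) (.var 2))) hf hg

theorem mul (hf : ArithmeticalFun f) (hg : ArithmeticalFun g) :
    ArithmeticalFun fun v => f v * g v :=
  bind₂ (Arithmetical.term_eq (.var 0) (Arith.mul (.var 1) (.var 2))) hf hg

end ArithmeticalFun

namespace Arithmetical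

variable {f g h : (ℕ → ℕ) → ℕ}

theorem eq (hf : ArithmeticalFun f) (hg : ArithmeticalFun g) : Arithmetical fun v => f v = g v :=
  bind (P := fun v x => x = g v) hf hg.graph

theorem lt (hf : ArithmeticalFun f) (hg : ArithmeticalFun g) : Arithmetical fun v => f v < g v :=
  (ex (P := fun v x => f v + x + 1 = g v)
    (eq ((hf.shift.add (.var 0)).add (.const 1)) hg.shift)).congr fun v =>
      ⟨fun h => ⟨g v - f v - 1, by omega⟩, fun ⟨x, h⟩ => by omega⟩

theorem mem {S : ℕ → Prop} (hf : ArithmeticalFun f) (hS : ArithmeticalSet S) :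
    Arithmetical fun v => S (f v) :=
  bind (P := fun _ x => S x) hf hS

theorem rel₃ {R : ℕ → ℕ → ℕ → Prop} (hR : Arithmetical fun v => R (v 0) (v 1) (v 2))
    (hf : ArithmeticalFun f) (hg : ArithmeticalFun g) (hh : ArithmeticalFun h) :
    Arithmetical fun v => R (f v) (g v) (h v) :=
  bind (P := fun v x => R x (g v) (h v)) hf
    (bind (P := fun v y => R (v 0) y (h fun n => v (n + 1))) hg.shift
      (bind (P := fun v z => R (v 1) (v 0) z) hh.shift.shift
        (hR.rename fun | 0 => 2 | 1 => 1 | 2 => 0 | n => n)))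

end Arithmetical

namespace ArithmeticalFun

variable {f g : (ℕ → ℕ) → ℕ}

theorem pair (hf : ArithmeticalFun f) (hg : ArithmeticalFun g) :
    ArithmeticalFun fun v => Nat.pair (f v) (g v) := by
  refine bind₂ (F := Nat.pair) (Arithmetical.congr (P := fun v =>
    (v 1 < v 2 ∧ v 0 = v 2 * v 2 + v 1) ∨ (¬ v 1 < v 2 ∧ v 0 = v 1 * v 1 + v 1 + v 2)) ?_ ?_) hf hg
  · apply_rules [Arithmetical.and, Arithmetical.or, Arithmetical.not, Arithmetical.eq,
      Arithmetical.lt, add, mul, var]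
  · intro v
    by_cases h : v 1 < v 2 <;> simp [Nat.pair, h]

theorem beta (hf : ArithmeticalFun f) (hg : ArithmeticalFun g) :
    ArithmeticalFun fun v => Nat.beta (f v) (g v) := by
  -- The value is the remainder of `p` modulo `(v 2 + 1) * q + 1`, and `y` is the quotient.
  refine bind₂ (F := Nat.beta) (Arithmetical.congr (P := fun v => ∃ p q y, v 1 = Nat.pair p q ∧
    v 0 < (v 2 + 1) * q + 1 ∧ p = ((v 2 + 1) * q + 1) * y + v 0) ?_ ?_) hf hg
  · apply_rules [Arithmetical.ex, Arithmetical.and, Arithmetical.eq, Arithmetical.lt, add, mul,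
      pair, var, const]
  · intro v
    constructor
    · intro h
      refine ⟨(v 1).unpair.1, (v 1).unpair.2, (v 1).unpair.1 / ((v 2 + 1) * (v 1).unpair.2 + 1),
        (Nat.pair_unpair _).symm, ?_, ?_⟩
      · rw [h]; exact Nat.mod_lt _ (Nat.succ_pos _)
      · rw [h]; exact (Nat.div_add_mod _ _).symm
    · rintro ⟨p, q, y, h1, h2, h3⟩
      rw [h1, Nat.beta]
      simp only [Nat.unpair_pair]
      rw [h3, Nat.mul_add_mod, Nat.mod_eq_of_lt h2]

end ArithmeticalFun

/-! ### Inductively generated sets -/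

/-- The least set of numbers that contains `Q` and is closed under the two-premise rule `R`. -/
inductive Generated (Q : ℕ → Prop) (R : ℕ → ℕ → ℕ → Prop) : ℕ → Prop
  | base {x : ℕ} : Q x → Generated Q R x
  | step {x y z : ℕ} : Generated Q R x → Generated Q R y → R x y z → Generated Q R z

/-- A list each of whose entries lies in `Q` or follows by `R` from entries further down. -/
inductive IsGeneration (Q : ℕ → Prop) (R : ℕ → ℕ → ℕ → Prop) : List ℕ → Prop
  | nil : IsGeneration Q R []
  | base {x : ℕ} {l : List ℕ} : Q x → IsGeneration Q R l → IsGeneration Q R (x :: l)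
  | step {x y z : ℕ} {l : List ℕ} : x ∈ l → y ∈ l → R x y z → IsGeneration Q R l →
      IsGeneration Q R (z :: l)

namespace Generated

variable {Q : ℕ → Prop} {R : ℕ → ℕ → ℕ → Prop}

theorem _root_.IsGeneration.append {l m : List ℕ} (hl : IsGeneration Q R l)
    (hm : IsGeneration Q R m) : IsGeneration Q R (l ++ m) := by
  induction hl with
  | nil => exact hm
  | base hx _ ih => exact .base hx ih
  | step hx hy h _ ih =>
    exact .step (List.mem_append_left _ hx) (List.mem_append_left _ hy) h ih

theorem exists_isGeneration {x : ℕ} (h : Generated Q R x) :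
    ∃ l, IsGeneration Q R (x :: l) := by
  induction h with
  | base hx => exact ⟨[], .base hx .nil⟩
  | step _ _ h ihx ihy =>
    obtain ⟨l, hl⟩ := ihx
    obtain ⟨m, hm⟩ := ihy
    exact ⟨_, .step (by simp) (by simp) h (hl.append hm)⟩

theorem _root_.IsGeneration.justified {l : List ℕ} (hl : IsGeneration Q R l) :
    ∀ i (hi : i < l.length), Q l[i] ∨ ∃ (j k : ℕ) (hj : j < l.length) (hk : k < l.length),
      i < j ∧ i < k ∧ R l[j] l[k] l[i] := by
  induction hl with
  | nil => exact fun i hi => absurd hi (Nat.not_lt_zero i)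
  | base hx _ ih =>
    rintro (_ | i) hi
    · exact .inl hx
    · refine (ih i (by simpa using hi)).imp id ?_
      rintro ⟨j, k, hj, hk, hij, hik, h⟩
      exact ⟨j + 1, k + 1, by simpa using hj, by simpa using hk, by omega, by omega, h⟩
  | step hx hy hz _ ih =>
    rintro (_ | i) hi
    · obtain ⟨j, hj, rfl⟩ := List.getElem_of_mem hx
      obtain ⟨k, hk, rfl⟩ := List.getElem_of_mem hy
      exact .inr ⟨j + 1, k + 1, by simpa using hj, by simpa using hk, by omega, by omega, hz⟩
    · refine (ih i (by simpa using hi)).imp id ?_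
      rintro ⟨j, k, hj, hk, hij, hik, h⟩
      exact ⟨j + 1, k + 1, by simpa using hj, by simpa using hk, by omega, by omega, h⟩

/-- Membership in a generated set, in terms of a generation coded by Gödel's beta function. -/
theorem iff_beta {x : ℕ} : Generated Q R x ↔ ∃ w n, Nat.beta w 0 = x ∧ 0 < n ∧ ∀ i, i < n →
    (Q (Nat.beta w i) ∨ ∃ j k, j < n ∧ k < n ∧ i < j ∧ i < k ∧
      R (Nat.beta w j) (Nat.beta w k) (Nat.beta w i)) := by
  constructor
  · intro h
    obtain ⟨l, hl⟩ := h.exists_isGeneration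
    have hb : ∀ i (hi : i < (x :: l).length), Nat.beta (Nat.unbeta (x :: l)) i = (x :: l)[i] :=
      fun i hi => Nat.beta_unbeta_coe (x :: l) ⟨i, hi⟩
    refine ⟨Nat.unbeta (x :: l), (x :: l).length, hb 0 (by simp), by simp, fun i hi => ?_⟩
    rw [hb i hi]
    refine (hl.justified i hi).imp id ?_
    rintro ⟨j, k, hj, hk, hij, hik, h⟩
    exact ⟨j, k, hj, hk, hij, hik, by rwa [hb j hj, hb k hk]⟩
  · rintro ⟨w, n, rfl, hn, h⟩
    -- The entries are generated from the end of the sequence to its head.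
    have key : ∀ m i, i + m = n → 0 < m → Generated Q R (Nat.beta w i) := by
      intro m
      induction m using Nat.strong_induction_on with
      | _ m ih =>
        intro i him hm
        rcases h i (by omega) with hQ | ⟨j, k, hj, hk, hij, hik, hR⟩
        · exact .base hQ
        · exact .step (ih (n - j) (by omega) j (by omega) (by omega))
            (ih (n - k) (by omega) k (by omega) (by omega)) hR
    exact key n 0 (by omega) hn

theorem arithmetical (hQ : ArithmeticalSet Q)
    (hR : Arithmetical fun v => R (v 0) (v 1) (v 2)) : ArithmeticalSet (Generated Q R) := by
  refine Arithmetical.congr ?_ fun v => iff_beta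
  apply_rules [Arithmetical.ex, Arithmetical.and, Arithmetical.or, Arithmetical.all,
    Arithmetical.imp, Arithmetical.eq, Arithmetical.lt, Arithmetical.mem (hS := hQ),
    Arithmetical.rel₃ hR, ArithmeticalFun.beta, ArithmeticalFun.var, ArithmeticalFun.const]

end Generated

/-! ### Codes of terms and formulas -/

/-- The code of a labelled node of a syntax tree with at most two children, an absent child being
`0`. The labels `0, …, 8` stand for variables (with the number of the variable as the first child),
`0`, `s`, `+`, `·`, `=`, `¬`, `∨` and `∃`. It is irreducible so that unification does not look into
the pairing function. -/
@[irreducible] def node (k a b : ℕ) : ℕ := Nat.pair k (Nat.pair a b)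

@[simp] theorem node_inj {k a b k' a' b' : ℕ} :
    node k a b = node k' a' b' ↔ k = k' ∧ a = a' ∧ b = b' := by
  simp [node, Nat.pair_eq_pair]

theorem ArithmeticalFun.node {f g h : (ℕ → ℕ) → ℕ} (hf : ArithmeticalFun f)
    (hg : ArithmeticalFun g) (hh : ArithmeticalFun h) :
    ArithmeticalFun fun v => node (f v) (g v) (h v) := by
  unfold _root_.node
  exact hf.pair (hg.pair hh)

abbrev varCode (n : ℕ) : ℕ := node 0 n 0
abbrev zeroCode : ℕ := node 1 0 0
abbrev succCode (a : ℕ) : ℕ := node 2 a 0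
abbrev addCode (a b : ℕ) : ℕ := node 3 a b
abbrev mulCode (a b : ℕ) : ℕ := node 4 a b
abbrev eqCode (a b : ℕ) : ℕ := node 5 a b
abbrev negCode (a : ℕ) : ℕ := node 6 a 0
abbrev orCode (a b : ℕ) : ℕ := node 7 a b
abbrev exCode (a : ℕ) : ℕ := node 8 a 0
abbrev impCode (a b : ℕ) : ℕ := orCode (negCode a) b
abbrev andCode (a b : ℕ) : ℕ := negCode (orCode (negCode a) (negCode b))
abbrev allCode (a : ℕ) : ℕ := negCode (exCode (negCode a))

/-- The Gödel number of an arithmetical term. -/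
def Term.code : Term arithmetic → ℕ
  | .var n => varCode n
  | .app ArithFun.zero _ => zeroCode
  | .app ArithFun.succ ts => succCode (ts 0).code
  | .app ArithFun.add ts => addCode (ts 0).code (ts 1).code
  | .app ArithFun.mul ts => mulCode (ts 0).code (ts 1).code

/-- The Gödel number of an arithmetical formula. -/
def Formula.code : Formula arithmetic → ℕ
  | .eq t u => eqCode t.code u.code
  | .rel R _ => R.elim
  | .neg A => negCode A.code
  | .or A B => orCode A.code B.code
  | .ex A => exCode A.code

namespace Arith

@[simp] theorem code_var (n : ℕ) : Term.code (.var n) = varCode n := rfl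
@[simp] theorem code_zero : zero.code = zeroCode := rfl
@[simp] theorem code_succ (t : Term arithmetic) : (succ t).code = succCode t.code := rfl
@[simp] theorem code_add (t u : Term arithmetic) : (add t u).code = addCode t.code u.code := rfl
@[simp] theorem code_mul (t u : Term arithmetic) : (mul t u).code = mulCode t.code u.code := rfl

theorem term_code_injective : Function.Injective Term.code := by
  intro t
  induction t using term_induction with
  | var n => intro u; induction u using term_induction <;> simp
  | zero => intro u; induction u using term_induction <;> simp
  | succ t ih =>
    intro u
    induction u using term_induction <;> simp
    exact fun h => congrArg succ (ih h)
  | add t t' ih ih' =>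
    intro u
    induction u using term_induction <;> simp
    exact fun h h' => congrArg₂ add (ih h) (ih' h')
  | mul t t' ih ih' =>
    intro u
    induction u using term_induction <;> simp
    exact fun h h' => congrArg₂ mul (ih h) (ih' h')

theorem formula_code_injective : Function.Injective Formula.code := by
  intro A
  induction A with
  | eq t u =>
    rintro (_ | ⟨⟨⟩, _⟩ | _ | _ | _) <;> simp [Formula.code]
    exact fun h h' => ⟨term_code_injective h, term_code_injective h'⟩
  | rel R => exact R.elim
  | neg A ih =>
    rintro (_ | ⟨⟨⟩, _⟩ | _ | _ | _) <;> simp [Formula.code]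
    exact fun h => ih h
  | or A B ihA ihB =>
    rintro (_ | ⟨⟨⟩, _⟩ | _ | _ | _) <;> simp [Formula.code]
    exact fun h h' => ⟨ihA h, ihB h'⟩
  | ex A ih =>
    rintro (_ | ⟨⟨⟩, _⟩ | _ | _ | _) <;> simp [Formula.code]
    exact fun h => ih h

theorem exists_of_code_eq_neg {A : Formula arithmetic} {a : ℕ} (h : A.code = negCode a) :
    ∃ B : Formula arithmetic, A = .neg B ∧ B.code = a := by
  rcases A with _ | ⟨⟨⟩, _⟩ | B | _ | _ <;> simp [Formula.code] at h
  exact ⟨B, rfl, h⟩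

theorem exists_of_code_eq_or {A : Formula arithmetic} {a b : ℕ} (h : A.code = orCode a b) :
    ∃ B C : Formula arithmetic, A = .or B C ∧ B.code = a ∧ C.code = b := by
  rcases A with _ | ⟨⟨⟩, _⟩ | _ | ⟨B, C⟩ | _ <;> simp [Formula.code] at h
  exact ⟨B, C, rfl, h⟩

theorem exists_of_code_eq_imp {A : Formula arithmetic} {a b : ℕ} (h : A.code = impCode a b) :
    ∃ B C : Formula arithmetic, A = .imp B C ∧ B.code = a ∧ C.code = b := by
  obtain ⟨B', C, rfl, hB, hC⟩ := exists_of_code_eq_or h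
  obtain ⟨B, rfl, hB'⟩ := exists_of_code_eq_neg hB
  exact ⟨B, C, rfl, hB', hC⟩

end Arith

/-- The numbers that are codes of terms. -/
def IsTermCode : ℕ → Prop :=
  Generated (fun x => (∃ n, x = varCode n) ∨ x = zeroCode)
    fun x y z => z = succCode x ∨ z = addCode x y ∨ z = mulCode x y

theorem isTermCode_iff {x : ℕ} : IsTermCode x ↔ ∃ t : Term arithmetic, t.code = x := by
  constructor
  · intro h
    induction h with
    | base h =>
      rcases h with ⟨n, rfl⟩ | rfl
      · exact ⟨.var n, rfl⟩
      · exact ⟨Arith.zero, rfl⟩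
    | step _ _ h ihx ihy =>
      obtain ⟨t, rfl⟩ := ihx
      obtain ⟨u, rfl⟩ := ihy
      rcases h with rfl | rfl | rfl
      · exact ⟨Arith.succ t, rfl⟩
      · exact ⟨Arith.add t u, rfl⟩
      · exact ⟨Arith.mul t u, rfl⟩
  · rintro ⟨t, rfl⟩
    induction t using Arith.term_induction with
    | var n => exact .base (.inl ⟨n, rfl⟩)
    | zero => exact .base (.inr rfl)
    | succ t ih => exact .step ih ih (.inl rfl)
    | add t u iht ihu => exact .step iht ihu (.inr (.inl rfl))
    | mul t u iht ihu => exact .step iht ihu (.inr (.inr rfl))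

theorem Arithmetical.isTermCode {f : (ℕ → ℕ) → ℕ} (hf : ArithmeticalFun f) :
    Arithmetical fun v => IsTermCode (f v) := by
  refine mem hf (Generated.arithmetical ?_ ?_) <;>
  apply_rules [or, ex, eq, ArithmeticalFun.node, ArithmeticalFun.var, ArithmeticalFun.const]

/-- The numbers that are codes of formulas. -/
def IsFormulaCode : ℕ → Prop :=
  Generated (fun x => ∃ a b, IsTermCode a ∧ IsTermCode b ∧ x = eqCode a b)
    fun x y z => z = negCode x ∨ z = orCode x y ∨ z = exCode x

theorem isFormulaCode_iff {x : ℕ} : IsFormulaCode x ↔ ∃ A : Formula arithmetic, A.code = x := by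
  constructor
  · intro h
    induction h with
    | base h =>
      obtain ⟨a, b, ha, hb, rfl⟩ := h
      obtain ⟨t, rfl⟩ := isTermCode_iff.1 ha
      obtain ⟨u, rfl⟩ := isTermCode_iff.1 hb
      exact ⟨.eq t u, rfl⟩
    | step _ _ h ihx ihy =>
      obtain ⟨A, rfl⟩ := ihx
      obtain ⟨B, rfl⟩ := ihy
      rcases h with rfl | rfl | rfl
      · exact ⟨.neg A, rfl⟩
      · exact ⟨.or A B, rfl⟩
      · exact ⟨.ex A, rfl⟩
  · rintro ⟨A, rfl⟩
    induction A with
    | eq t u => exact .base ⟨_, _, isTermCode_iff.2 ⟨t, rfl⟩, isTermCode_iff.2 ⟨u, rfl⟩, rfl⟩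
    | rel R => exact R.elim
    | neg A ih => exact .step ih ih (.inl rfl)
    | or A B ihA ihB => exact .step ihA ihB (.inr (.inl rfl))
    | ex A ih => exact .step ih ih (.inr (.inr rfl))

theorem Arithmetical.isFormulaCode {f : (ℕ → ℕ) → ℕ} (hf : ArithmeticalFun f) :
    Arithmetical fun v => IsFormulaCode (f v) := by
  refine mem hf (Generated.arithmetical ?_ ?_) <;>
  apply_rules [and, or, ex, eq, isTermCode, ArithmeticalFun.node, ArithmeticalFun.var,
    ArithmeticalFun.const]

/-! ### Substitution is arithmetical -/

/-- The substitution `0 ↦ t`, `n + 1 ↦ n + e`. With `e = 0` it instantiates the variable `0`; the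
renamings and the successor substitution of the induction axioms have this form too. -/
def Term.consShift (t : Term arithmetic) (e : ℕ) : ℕ → Term arithmetic
  | 0 => t
  | n + 1 => .var (n + e)

namespace Arith

theorem subst_shift_shift (t : Term arithmetic) (k : ℕ) :
    (t.subst fun i => .var (i + k)).subst (fun i => .var (i + 1)) =
      t.subst fun i => .var (i + (k + 1)) := by
  induction t using term_induction with
  | var n => rfl
  | zero => simp only [subst_zero]
  | succ t ih => simp only [subst_succ, ih]
  | add t u iht ihu => simp only [subst_add, iht, ihu]
  | mul t u iht ihu => simp only [subst_mul, iht, ihu]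

theorem subst_var (t : Term arithmetic) : t.subst .var = t := by
  induction t using term_induction with
  | var n => rfl
  | zero => simp only [subst_zero]
  | succ t ih => simp only [subst_succ, ih]
  | add t u iht ihu => simp only [subst_add, iht, ihu]
  | mul t u iht ihu => simp only [subst_mul, iht, ihu]

theorem iterate_up_of_lt (σ : ℕ → Term arithmetic) {n k : ℕ} (h : n < k) :
    Term.up^[k] σ n = .var n := by
  induction k generalizing n with
  | zero => exact absurd h (Nat.not_lt_zero n)
  | succ k ih =>
    rw [Function.iterate_succ_apply']
    cases n with
    | zero => rfl
    | succ n => rw [Term.up, ih (Nat.lt_of_succ_lt_succ h)]; rfl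

theorem iterate_up_add (σ : ℕ → Term arithmetic) (k m : ℕ) :
    Term.up^[k] σ (k + m) = (σ m).subst fun i => .var (i + k) := by
  induction k with
  | zero => simpa using (subst_var (σ m)).symm
  | succ k ih =>
    rw [Function.iterate_succ_apply', show k + 1 + m = (k + m) + 1 by omega, Term.up, ih,
      subst_shift_shift]

theorem consShift_var (k : ℕ) :
    Term.consShift (.var k) (k + 1) = fun i => .var (i + k) := by
  funext i
  cases i with
  | zero => simp [Term.consShift]
  | succ i => simp [Term.consShift]; omega

end Arith

/-- The code of a quintuple, irreducible for the same reason as `node`. -/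
@[irreducible] def quint (t e k c d : ℕ) : ℕ := Nat.pair t (Nat.pair e (Nat.pair k (Nat.pair c d)))

@[simp] theorem quint_inj {t e k c d t' e' k' c' d' : ℕ} :
    quint t e k c d = quint t' e' k' c' d' ↔ t = t' ∧ e = e' ∧ k = k' ∧ c = c' ∧ d = d' := by
  simp [quint, Nat.pair_eq_pair]

theorem ArithmeticalFun.quint {f₁ f₂ f₃ f₄ f₅ : (ℕ → ℕ) → ℕ} (h₁ : ArithmeticalFun f₁)
    (h₂ : ArithmeticalFun f₂) (h₃ : ArithmeticalFun f₃) (h₄ : ArithmeticalFun f₄)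
    (h₅ : ArithmeticalFun f₅) :
    ArithmeticalFun fun v => quint (f₁ v) (f₂ v) (f₃ v) (f₄ v) (f₅ v) := by
  unfold _root_.quint
  exact h₁.pair (h₂.pair (h₃.pair (h₄.pair h₅)))

/-- The quintuples `(t, e, k, c, d)` such that the substitution `consShift t e`, pushed under `k`
quantifiers, turns the term `c` into the term `d`. Where it puts `t`, the variables of `t` have to
be raised by `k`; this is the case `consShift (var k) (k + 1)` of the same relation. -/
def IsTermSubst : ℕ → Prop :=
  Generated
    (fun x => ∃ t e, IsTermCode t ∧
      (x = quint t e 0 (varCode 0) t ∨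
        ∃ k, x = quint t e k zeroCode zeroCode ∨
          ∃ n, (n < k ∧ x = quint t e k (varCode n) (varCode n)) ∨
            x = quint t e k (varCode (k + n + 1)) (varCode (n + e + k))))
    fun x y z => ∃ t e k d,
      (x = quint (varCode k) (k + 1) 0 t d ∧ z = quint t e k (varCode k) d) ∨
        ∃ c, x = quint t e k c d ∧
          (z = quint t e k (succCode c) (succCode d) ∨
            ∃ c' d', y = quint t e k c' d' ∧
              (z = quint t e k (addCode c c') (addCode d d') ∨
                z = quint t e k (mulCode c c') (mulCode d d')))

theorem isTermSubst_iff {x : ℕ} : IsTermSubst x ↔ ∃ (t : Term arithmetic) (e k : ℕ)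
    (s : Term arithmetic),
    x = quint t.code e k s.code (s.subst (Term.up^[k] (t.consShift e))).code := by
  constructor
  · intro h
    induction h with
    | base h =>
      obtain ⟨t, e, ht, h⟩ := h
      obtain ⟨t, rfl⟩ := isTermCode_iff.1 ht
      rcases h with rfl | ⟨k, rfl | ⟨n, ⟨hn, rfl⟩ | rfl⟩⟩
      · exact ⟨t, e, 0, .var 0, rfl⟩
      · exact ⟨t, e, k, Arith.zero, by rw [Arith.subst_zero]; rfl⟩
      · exact ⟨t, e, k, .var n, by rw [Term.subst, Arith.iterate_up_of_lt _ hn]; rfl⟩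
      · exact ⟨t, e, k, .var (k + n + 1), by
          rw [Term.subst, Nat.add_assoc, Arith.iterate_up_add]; rfl⟩
    | step _ _ h ihx ihy =>
      obtain ⟨t, e, k, d, ⟨rfl, rfl⟩ | ⟨c, rfl, h⟩⟩ := h
      · obtain ⟨u, e', k', t, h⟩ := ihx
        simp only [quint_inj] at h
        obtain ⟨hu, rfl, rfl, rfl, rfl⟩ := h
        obtain rfl : u = .var k := Arith.term_code_injective hu.symm
        refine ⟨t, e, k, .var k, ?_⟩
        have := Arith.iterate_up_add (t.consShift e) k 0
        rw [Nat.add_zero] at this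
        rw [Term.subst, this, Function.iterate_zero, id, Arith.consShift_var]
        rfl
      · obtain ⟨t, e, k, s, h'⟩ := ihx
        simp only [quint_inj] at h'
        obtain ⟨rfl, rfl, rfl, rfl, rfl⟩ := h'
        obtain rfl | ⟨c', d', rfl, h⟩ := h
        · exact ⟨t, e, k, Arith.succ s, by rw [Arith.subst_succ]; rfl⟩
        · obtain ⟨t', e, k, s', h'⟩ := ihy
          simp only [quint_inj] at h'
          obtain ⟨ht, rfl, rfl, rfl, rfl⟩ := h'
          obtain rfl := Arith.term_code_injective ht
          obtain rfl | rfl := h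
          · exact ⟨t, _, _, Arith.add s s', by rw [Arith.subst_add]; rfl⟩
          · exact ⟨t, _, _, Arith.mul s s', by rw [Arith.subst_mul]; rfl⟩
  · rintro ⟨t, e, k, s, rfl⟩
    -- At depth `0` every variable is covered by a base clause.
    have zero_var (t : Term arithmetic) (e n : ℕ) : IsTermSubst
        (quint t.code e 0 (varCode n) (Term.consShift t e n).code) := by
      cases n with
      | zero => exact .base ⟨_, _, isTermCode_iff.2 ⟨t, rfl⟩, .inl rfl⟩
      | succ n =>
        exact .base ⟨t.code, e, isTermCode_iff.2 ⟨t, rfl⟩, .inr ⟨0, .inr ⟨n, .inr (by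
          simp [Term.consShift])⟩⟩⟩
    -- At a fixed depth, the case of variables settles all terms.
    have lift (t : Term arithmetic) (e k : ℕ)
        (hvar : ∀ n, IsTermSubst
          (quint t.code e k (varCode n) (Term.up^[k] (t.consShift e) n).code))
        (s : Term arithmetic) : IsTermSubst
          (quint t.code e k s.code (s.subst (Term.up^[k] (t.consShift e))).code) := by
      induction s using Arith.term_induction with
      | var n => exact hvar n
      | zero =>
        rw [Arith.subst_zero]
        exact .base ⟨_, _, isTermCode_iff.2 ⟨t, rfl⟩, .inr ⟨k, .inl rfl⟩⟩
      | succ s ih =>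
        rw [Arith.subst_succ]
        exact .step ih ih ⟨_, _, _, _, .inr ⟨_, rfl, .inl rfl⟩⟩
      | add s s' ih ih' =>
        rw [Arith.subst_add]
        exact .step ih ih' ⟨_, _, _, _, .inr ⟨_, rfl, .inr ⟨_, _, rfl, .inl rfl⟩⟩⟩
      | mul s s' ih ih' =>
        rw [Arith.subst_mul]
        exact .step ih ih' ⟨_, _, _, _, .inr ⟨_, rfl, .inr ⟨_, _, rfl, .inr rfl⟩⟩⟩
    refine lift t e k (fun n => ?_) s
    rcases lt_or_ge n k with hn | hn
    · rw [Arith.iterate_up_of_lt _ hn]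
      exact .base ⟨_, _, isTermCode_iff.2 ⟨t, rfl⟩, .inr ⟨k, .inr ⟨n, .inl ⟨hn, rfl⟩⟩⟩⟩
    · obtain ⟨m, rfl⟩ := Nat.exists_eq_add_of_le hn
      rw [Arith.iterate_up_add]
      cases m with
      | zero =>
        -- The variable `k` becomes `t` raised by `k`, a substitution at depth `0`.
        have h := lift (.var k) (k + 1) 0 (zero_var _ _) t
        rw [Function.iterate_zero, id, Arith.consShift_var] at h
        exact .step h h ⟨_, _, _, _, .inl ⟨rfl, rfl⟩⟩
      | succ m =>
        exact .base ⟨_, _, isTermCode_iff.2 ⟨t, rfl⟩, .inr ⟨k, .inr ⟨m, .inr rfl⟩⟩⟩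

theorem Arithmetical.isTermSubst {f : (ℕ → ℕ) → ℕ} (hf : ArithmeticalFun f) :
    Arithmetical fun v => IsTermSubst (f v) := by
  refine mem hf (Generated.arithmetical ?_ ?_) <;>
  apply_rules (maxDepth := 1000) [and, or, ex, eq, lt, isTermCode,
    ArithmeticalFun.quint, ArithmeticalFun.node, ArithmeticalFun.add, ArithmeticalFun.var,
    ArithmeticalFun.const]

/-- The quintuples `(t, e, k, a, b)` such that the substitution `consShift t e`, pushed under `k`
quantifiers, turns the formula `a` into the formula `b`. -/
def IsFormulaSubst : ℕ → Prop :=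
  Generated
    (fun x => ∃ t e k c d c' d', IsTermSubst (quint t e k c d) ∧ IsTermSubst (quint t e k c' d') ∧
      x = quint t e k (eqCode c c') (eqCode d d'))
    fun x y z => ∃ t e k a b,
      (x = quint t e (k + 1) a b ∧ z = quint t e k (exCode a) (exCode b)) ∨
        x = quint t e k a b ∧
          (z = quint t e k (negCode a) (negCode b) ∨
            ∃ a' b', y = quint t e k a' b' ∧ z = quint t e k (orCode a a') (orCode b b'))

theorem isFormulaSubst_iff {x : ℕ} : IsFormulaSubst x ↔ ∃ (t : Term arithmetic) (e k : ℕ)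
    (A : Formula arithmetic),
    x = quint t.code e k A.code (A.subst (Term.up^[k] (t.consShift e))).code := by
  constructor
  · intro h
    induction h with
    | base h =>
      obtain ⟨t, e, k, c, d, c', d', h, h', rfl⟩ := h
      obtain ⟨t, e, k, s, h⟩ := isTermSubst_iff.1 h
      simp only [quint_inj] at h
      obtain ⟨rfl, rfl, rfl, rfl, rfl⟩ := h
      obtain ⟨t', e, k, s', h'⟩ := isTermSubst_iff.1 h'
      simp only [quint_inj] at h'
      obtain ⟨ht, rfl, rfl, rfl, rfl⟩ := h'
      obtain rfl := Arith.term_code_injective ht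
      exact ⟨t, _, _, .eq s s', rfl⟩
    | step _ _ h ihx ihy =>
      obtain ⟨t, e, k, a, b, ⟨rfl, rfl⟩ | ⟨rfl, h⟩⟩ := h
      · obtain ⟨t, e, k', A, h⟩ := ihx
        simp only [quint_inj] at h
        obtain ⟨rfl, rfl, rfl, rfl, rfl⟩ := h
        refine ⟨t, e, k, .ex A, ?_⟩
        rw [Formula.subst, ← Function.iterate_succ_apply' Term.up]
        rfl
      · obtain ⟨t, e, k, A, h'⟩ := ihx
        simp only [quint_inj] at h'
        obtain ⟨rfl, rfl, rfl, rfl, rfl⟩ := h'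
        obtain rfl | ⟨a', b', rfl, rfl⟩ := h
        · exact ⟨t, e, k, .neg A, rfl⟩
        · obtain ⟨t', e, k, B, h'⟩ := ihy
          simp only [quint_inj] at h'
          obtain ⟨ht, rfl, rfl, rfl, rfl⟩ := h'
          obtain rfl := Arith.term_code_injective ht
          exact ⟨t, _, _, .or A B, rfl⟩
  · rintro ⟨t, e, k, A, rfl⟩
    induction A generalizing k with
    | eq s s' =>
      exact .base ⟨_, _, _, _, _, _, _, isTermSubst_iff.2 ⟨t, e, k, s, rfl⟩,
        isTermSubst_iff.2 ⟨t, e, k, s', rfl⟩, rfl⟩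
    | rel R => exact R.elim
    | neg A ih => exact .step (ih k) (ih k) ⟨_, _, _, _, _, .inr ⟨rfl, .inl rfl⟩⟩
    | or A B ihA ihB =>
      exact .step (ihA k) (ihB k) ⟨_, _, _, _, _, .inr ⟨rfl, .inr ⟨_, _, rfl, rfl⟩⟩⟩
    | ex A ih =>
      rw [Formula.subst, ← Function.iterate_succ_apply' Term.up]
      exact .step (ih (k + 1)) (ih (k + 1)) ⟨_, _, _, _, _, .inl ⟨rfl, rfl⟩⟩

theorem Arithmetical.isFormulaSubst {f : (ℕ → ℕ) → ℕ} (hf : ArithmeticalFun f) :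
    Arithmetical fun v => IsFormulaSubst (f v) := by
  refine mem hf (Generated.arithmetical ?_ ?_) <;>
  apply_rules (maxDepth := 1000) [and, or, ex, eq, isTermSubst,
    ArithmeticalFun.quint, ArithmeticalFun.node, ArithmeticalFun.add, ArithmeticalFun.var,
    ArithmeticalFun.const]

/-- `b` is the code of the formula that `consShift t e` makes of the formula with code `a`. -/
abbrev SubstCode (t e a b : ℕ) : Prop := IsFormulaSubst (quint t e 0 a b)

theorem substCode_code (A : Formula arithmetic) (t : Term arithmetic) (e : ℕ) :
    SubstCode t.code e A.code (A.subst (t.consShift e)).code :=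
  isFormulaSubst_iff.2 ⟨t, e, 0, A, rfl⟩

theorem SubstCode.exists {t e a b : ℕ} (h : SubstCode t e a b) :
    ∃ (T : Term arithmetic) (A : Formula arithmetic),
      T.code = t ∧ A.code = a ∧ (A.subst (T.consShift e)).code = b := by
  obtain ⟨T, e, k, A, h⟩ := isFormulaSubst_iff.1 h
  simp only [quint_inj] at h
  obtain ⟨rfl, rfl, rfl, rfl, rfl⟩ := h
  exact ⟨T, A, rfl, rfl, rfl⟩

namespace Arith

theorem inst_eq (A : Formula arithmetic) (t : Term arithmetic) :
    A.inst t = A.subst (t.consShift 0) :=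
  congrArg A.subst (funext fun n => by cases n <;> rfl)

theorem lift_eq (A : Formula arithmetic) : A.lift = A.subst (Term.consShift (.var 1) 2) :=
  congrArg A.subst (funext fun n => by cases n <;> rfl)

theorem atSucc_eq (A : Formula arithmetic) :
    atSucc A = A.subst (Term.consShift (succ (.var 0)) 1) :=
  congrArg A.subst (funext fun n => by cases n <;> rfl)

/-- The numeral of `n`, that is `s(…s(0))`. -/
def numeral : ℕ → Term arithmetic
  | 0 => zero
  | n + 1 => succ (numeral n)

theorem val_numeral (v : ℕ → ℕ) (n : ℕ) : (numeral n).val v = n := by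
  induction n with
  | zero => rfl
  | succ n ih => rw [numeral, val_succ, ih]

theorem below_numeral (k n : ℕ) : (numeral n).Below k := by
  induction n with
  | zero => exact below_zero
  | succ n ih => exact below_succ.2 ih

end Arith

/-- The pairs of a number and the code of its numeral. -/
def IsNumeralPair : ℕ → Prop :=
  Generated (fun x => x = Nat.pair 0 zeroCode)
    fun x _ z => ∃ n c, x = Nat.pair n c ∧ z = Nat.pair (n + 1) (succCode c)

theorem isNumeralPair_iff {x : ℕ} :
    IsNumeralPair x ↔ ∃ n, x = Nat.pair n (Arith.numeral n).code := by
  constructor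
  · intro h
    induction h with
    | base h => exact ⟨0, h⟩
    | step _ _ h ih _ =>
      obtain ⟨n, c, rfl, rfl⟩ := h
      obtain ⟨m, hm⟩ := ih
      obtain ⟨rfl, rfl⟩ := Nat.pair_eq_pair.1 hm
      exact ⟨n + 1, rfl⟩
  · rintro ⟨n, rfl⟩
    induction n with
    | zero => exact .base rfl
    | succ n ih => exact .step ih ih ⟨_, _, rfl, rfl⟩

theorem Arithmetical.isNumeralPair {f : (ℕ → ℕ) → ℕ} (hf : ArithmeticalFun f) :
    Arithmetical fun v => IsNumeralPair (f v) := by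
  refine mem hf (Generated.arithmetical ?_ ?_) <;>
  apply_rules (maxDepth := 1000) [and, or, ex, eq, ArithmeticalFun.pair,
    ArithmeticalFun.node, ArithmeticalFun.add, ArithmeticalFun.var, ArithmeticalFun.const]

/-! ### The theorems of arithmetic -/

/-- The axioms of a calculus that is sound for the standard model and at least as strong as number
theory: the logical axioms, the six single Peano axioms, and the induction axioms without universal
closure. -/
def IsAxiomCode (x : ℕ) : Prop :=
  (∃ a, IsFormulaCode a ∧ x = orCode (negCode a) a) ∨
  (∃ t a b, SubstCode t 0 a b ∧ x = impCode b (exCode a)) ∨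
  (∃ t, IsTermCode t ∧ x = eqCode t t) ∨
  (∃ t u a b c, SubstCode t 0 a b ∧ SubstCode u 0 a c ∧
    x = impCode (eqCode t u) (impCode b c)) ∨
  (∃ a b c, SubstCode zeroCode 0 a b ∧ SubstCode (succCode (varCode 0)) 1 a c ∧
    x = impCode (andCode b (allCode (impCode a c))) (allCode a)) ∨
  x = allCode (negCode (eqCode (succCode (varCode 0)) zeroCode)) ∨
  x = allCode (allCode (impCode (eqCode (succCode (varCode 1)) (succCode (varCode 0)))
    (eqCode (varCode 1) (varCode 0)))) ∨
  x = allCode (eqCode (addCode (varCode 0) zeroCode) (varCode 0)) ∨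
  x = allCode (allCode (eqCode (addCode (varCode 1) (succCode (varCode 0)))
    (succCode (addCode (varCode 1) (varCode 0))))) ∨
  x = allCode (eqCode (mulCode (varCode 0) zeroCode) zeroCode) ∨
  x = allCode (allCode (eqCode (mulCode (varCode 1) (succCode (varCode 0)))
    (addCode (mulCode (varCode 1) (varCode 0)) (varCode 1))))

/-- The rules of that calculus: those of number theory, and universal generalization, which makes
the closures of the induction axioms derivable. -/
def IsRuleCode (x y z : ℕ) : Prop :=
  (∃ a, IsFormulaCode a ∧ z = orCode a x) ∨
  x = orCode z z ∨
  (∃ a b c, x = orCode a (orCode b c) ∧ z = orCode (orCode a b) c) ∨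
  (∃ a b c, x = orCode a b ∧ y = orCode (negCode a) c ∧ z = orCode b c) ∨
  (∃ a b c, SubstCode (varCode 1) 2 b c ∧ x = impCode a c ∧ z = impCode (exCode a) b) ∨
  z = allCode x

/-- The codes of the formulas derivable in that calculus. -/
def IsTheoremCode : ℕ → Prop := Generated IsAxiomCode IsRuleCode

theorem Arithmetical.isTheoremCode {f : (ℕ → ℕ) → ℕ} (hf : ArithmeticalFun f) :
    Arithmetical fun v => IsTheoremCode (f v) := by
  refine mem hf (Generated.arithmetical ?_ ?_) <;>
  simp only [ArithmeticalSet, IsAxiomCode, IsRuleCode] <;>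
  apply_rules (maxDepth := 1000) [and, or, ex, eq, isTermCode, isFormulaCode, isFormulaSubst,
    ArithmeticalFun.quint, ArithmeticalFun.node, ArithmeticalFun.var, ArithmeticalFun.const]

namespace Arith

theorem isTheoremCode_closure {A : Formula arithmetic} (k : ℕ) (h : IsTheoremCode A.code) :
    IsTheoremCode (A.closure k).code := by
  induction k generalizing A with
  | zero => exact h
  | succ k ih => exact ih (.step h h (.inr (.inr (.inr (.inr (.inr rfl))))))

theorem isTheoremCode_of_isPeanoAxiom {A : Formula arithmetic} (h : IsPeanoAxiom A) :
    IsTheoremCode A.code := by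
  cases h with
  | induction k A hA =>
    refine isTheoremCode_closure k (.base ?_)
    have h0 := substCode_code A zero 0
    have hs := substCode_code A (succ (.var 0)) 1
    rw [← inst_eq] at h0
    rw [← atSucc_eq] at hs
    exact .inr (.inr (.inr (.inr (.inl ⟨_, _, _, h0, hs, rfl⟩))))
  | _ =>
    refine .base ?_
    unfold IsAxiomCode
    iterate 5 refine Or.inr ?_
    first
    | exact .inl rfl
    | exact .inr (.inl rfl)
    | exact .inr (.inr (.inl rfl))
    | exact .inr (.inr (.inr (.inl rfl)))
    | exact .inr (.inr (.inr (.inr (.inl rfl))))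
    | exact .inr (.inr (.inr (.inr (.inr rfl))))

theorem isTheoremCode_of_proves {A : Formula numberTheory.voc} (h : numberTheory.Proves A) :
    IsTheoremCode A.code := by
  induction h with
  | ax h => exact isTheoremCode_of_isPeanoAxiom h
  | excludedMiddle A => exact .base (.inl ⟨_, isFormulaCode_iff.2 ⟨A, rfl⟩, rfl⟩)
  | substitution A t =>
    have h := substCode_code A t 0
    rw [← inst_eq] at h
    exact .base (.inr (.inl ⟨_, _, _, h, rfl⟩))
  | identity t => exact .base (.inr (.inr (.inl ⟨_, isTermCode_iff.2 ⟨t, rfl⟩, rfl⟩)))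
  | equality A t u =>
    have ht := substCode_code A t 0
    have hu := substCode_code A u 0
    rw [← inst_eq] at ht hu
    exact .base (.inr (.inr (.inr (.inl ⟨_, _, _, _, _, ht, hu, rfl⟩))))
  | expansion B _ ih => exact .step ih ih (.inl ⟨_, isFormulaCode_iff.2 ⟨B, rfl⟩, rfl⟩)
  | contraction _ ih => exact .step ih ih (.inr (.inl rfl))
  | associativity _ ih => exact .step ih ih (.inr (.inr (.inl ⟨_, _, _, rfl, rfl⟩)))
  | cut _ _ ih ih' => exact .step ih ih' (.inr (.inr (.inr (.inl ⟨_, _, _, rfl, rfl, rfl⟩))))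
  | @exIntro A B _ ih =>
    have h := substCode_code B (.var 1) 2
    rw [← lift_eq] at h
    exact .step ih ih (.inr (.inr (.inr (.inr (.inl ⟨_, _, _, h, rfl, rfl⟩)))))

/-- Every axiom of the calculus is the code of a true formula. -/
theorem exists_holds_of_isAxiomCode {x : ℕ} (h : IsAxiomCode x) :
    ∃ A : Formula arithmetic, A.code = x ∧ ∀ v, A.Holds v := by
  rcases h with ⟨a, ha, rfl⟩ | ⟨t, a, b, h, rfl⟩ | ⟨t, ht, rfl⟩ | ⟨t, u, a, b, c, h, h', rfl⟩ |
    ⟨a, b, c, h, h', rfl⟩ | rfl | rfl | rfl | rfl | rfl | rfl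
  · obtain ⟨A, rfl⟩ := isFormulaCode_iff.1 ha
    exact ⟨.or (.neg A) A, rfl, fun v => (Classical.em (A.Holds v)).symm⟩
  · obtain ⟨t, A, rfl, rfl, rfl⟩ := h.exists
    refine ⟨.imp (A.inst t) (.ex A), by rw [inst_eq]; rfl, fun v => holds_imp.2 fun h => ?_⟩
    exact ⟨_, (holds_inst A t v).1 h⟩
  · obtain ⟨t, rfl⟩ := isTermCode_iff.1 ht
    exact ⟨.eq t t, rfl, fun v => rfl⟩
  · obtain ⟨t, A, rfl, rfl, rfl⟩ := h.exists
    obtain ⟨u, B, rfl, hB, rfl⟩ := h'.exists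
    obtain rfl := formula_code_injective hB
    refine ⟨.imp (.eq t u) (.imp (B.inst t) (B.inst u)), by rw [inst_eq, inst_eq]; rfl,
      fun v => holds_imp.2 fun h => holds_imp.2 ?_⟩
    rw [holds_inst, holds_inst, show t.val v = u.val v from h]
    exact id
  · obtain ⟨t, A, ht, rfl, rfl⟩ := h.exists
    obtain ⟨u, B, hu, hB, rfl⟩ := h'.exists
    obtain rfl := formula_code_injective hB
    obtain rfl : t = zero := term_code_injective ht
    obtain rfl : u = succ (.var 0) := term_code_injective hu
    refine ⟨induction B, ?_, holds_induction B⟩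
    rw [induction, inst_eq, atSucc_eq]
    rfl
  · exact ⟨.all (.neg (.eq (succ (.var 0)) zero)), rfl, fun v => holds_all.2 fun x =>
      Nat.succ_ne_zero x⟩
  · exact ⟨.all (.all (.imp (.eq (succ (.var 1)) (succ (.var 0))) (.eq (.var 1) (.var 0)))), rfl,
      fun v => holds_all.2 fun x => holds_all.2 fun y => holds_imp.2 fun h => Nat.succ.inj h⟩
  · exact ⟨.all (.eq (add (.var 0) zero) (.var 0)), rfl, fun v => holds_all.2 fun x => rfl⟩
  · exact ⟨.all (.all (.eq (add (.var 1) (succ (.var 0))) (succ (add (.var 1) (.var 0))))), rfl,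
      fun v => holds_all.2 fun x => holds_all.2 fun y => rfl⟩
  · exact ⟨.all (.eq (mul (.var 0) zero) zero), rfl, fun v => holds_all.2 fun x => rfl⟩
  · exact ⟨.all (.all (.eq (mul (.var 1) (succ (.var 0))) (add (mul (.var 1) (.var 0)) (.var 1)))),
      rfl, fun v => holds_all.2 fun x => holds_all.2 fun y => rfl⟩

/-- Soundness of the calculus for the standard model. -/
theorem exists_holds_of_isTheoremCode {x : ℕ} (h : IsTheoremCode x) :
    ∃ A : Formula arithmetic, A.code = x ∧ ∀ v, A.Holds v := by
  induction h with
  | base h => exact exists_holds_of_isAxiomCode h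
  | step _ _ h ihx ihy =>
    obtain ⟨A, hx, hA⟩ := ihx
    obtain ⟨A', hy, hA'⟩ := ihy
    rcases h with ⟨b, hb, rfl⟩ | rfl | ⟨a, b, c, rfl, rfl⟩ | ⟨a, b, c, rfl, rfl, rfl⟩ |
      ⟨a, b, c, h, rfl, rfl⟩ | rfl
    · obtain ⟨B, rfl⟩ := isFormulaCode_iff.1 hb
      exact ⟨.or B A, by rw [← hx]; rfl, fun v => .inr (hA v)⟩
    · obtain ⟨B, C, rfl, hB, hC⟩ := exists_of_code_eq_or hx
      obtain rfl := formula_code_injective (hB.trans hC.symm)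
      exact ⟨B, hB, fun v => (hA v).elim id id⟩
    · obtain ⟨B, C, rfl, rfl, hC⟩ := exists_of_code_eq_or hx
      obtain ⟨C, D, rfl, rfl, rfl⟩ := exists_of_code_eq_or hC
      exact ⟨.or (.or B C) D, rfl, fun v => or_assoc.2 (hA v)⟩
    · obtain ⟨B, C, rfl, rfl, rfl⟩ := exists_of_code_eq_or hx
      obtain ⟨B', D, rfl, hB, rfl⟩ := exists_of_code_eq_imp hy
      obtain rfl := formula_code_injective hB
      exact ⟨.or C D, rfl, fun v => (hA v).symm.imp_right fun h => holds_imp.1 (hA' v) h⟩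
    · obtain ⟨t, B, ht, rfl, rfl⟩ := h.exists
      obtain rfl : t = .var 1 := term_code_injective ht
      obtain ⟨C, D, rfl, rfl, hD⟩ := exists_of_code_eq_imp hx
      rw [← lift_eq] at hD
      obtain rfl := formula_code_injective hD
      refine ⟨.imp (.ex C) B, rfl, fun v => holds_imp.2 ?_⟩
      rintro ⟨y, hy⟩
      exact (holds_lift B y v).1 (holds_imp.1 (hA _) hy)
    · exact ⟨.all A, by rw [← hx]; rfl, fun v => holds_all.2 fun x => hA _⟩

theorem holds_of_isTheoremCode {A : Formula arithmetic} (h : IsTheoremCode A.code) (v : ℕ → ℕ) :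
    A.Holds v := by
  obtain ⟨B, hB, h'⟩ := exists_holds_of_isTheoremCode h
  obtain rfl := formula_code_injective hB
  exact h' v

/-! ### The diagonal argument -/

theorem _root_.Term.below_subst_of_forall {V : Vocabulary} {n : ℕ} {σ : ℕ → Term V}
    (hσ : ∀ i, (σ i).Below n) : ∀ t : Term V, (t.subst σ).Below n
  | .var i => hσ i
  | .app _ ts => fun i => Term.below_subst_of_forall hσ (ts i)

theorem _root_.Formula.below_subst_of_forall {V : Vocabulary} (A : Formula V) :
    ∀ {n : ℕ} {σ : ℕ → Term V}, (∀ i, (σ i).Below n) → (A.subst σ).Below n := by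
  induction A with
  | eq t u =>
    exact fun hσ => ⟨Term.below_subst_of_forall hσ t, Term.below_subst_of_forall hσ u⟩
  | rel R ts => exact fun hσ i => Term.below_subst_of_forall hσ (ts i)
  | neg A ih => exact fun hσ => ih hσ
  | or A B ihA ihB => exact fun hσ => ⟨ihA hσ, ihB hσ⟩
  | ex A ih =>
    intro n σ hσ
    refine ih (n := n + 1) fun i => ?_
    cases i with
    | zero => exact Nat.succ_pos n
    | succ i =>
      exact Term.Below.subst (m := n) (σ := fun j => .var (j + 1))
        (fun j hj => Nat.succ_lt_succ hj) (hσ i)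

/-- An arithmetical set is defined by a formula with at most the variable `0` free. -/
theorem exists_isPredicate {S : ℕ → Prop} (hS : ArithmeticalSet S) :
    ∃ D : Formula arithmetic, D.IsPredicate ∧ ∀ v, D.Holds v ↔ S (v 0) := by
  obtain ⟨D, hD⟩ := hS
  -- The other variables of a defining formula are irrelevant and may be set to zero.
  refine ⟨D.subst fun | 0 => .var 0 | _ + 1 => zero, ?_, fun v => ?_⟩
  · refine Formula.below_subst_of_forall D fun i => ?_
    cases i with
    | zero => exact Nat.one_pos
    | succ i => exact below_zero
  · rw [holds_subst, hD]
    rfl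

/-- The diagonal lemma in its semantic form: a sentence that is true if and only if its own code
is outside the given arithmetical set. -/
theorem exists_diagonal_sentence {S : ℕ → Prop} (hS : ArithmeticalSet S) :
    ∃ A : Formula arithmetic, A.IsSentence ∧ ∀ v, A.Holds v ↔ ¬ S A.code := by
  -- The codes of those `D(x)` for which the code of `D(n)` is outside `S`, `n` the code of `D(x)`.
  let T (n : ℕ) : Prop := ∃ c b, IsNumeralPair (Nat.pair n c) ∧ SubstCode c 0 n b ∧ ¬ S b
  have hT : ArithmeticalSet T := by
    refine Arithmetical.ex (Arithmetical.ex ?_)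
    apply_rules [Arithmetical.and, Arithmetical.not, Arithmetical.mem (hS := hS),
      Arithmetical.isNumeralPair, Arithmetical.isFormulaSubst, ArithmeticalFun.pair,
      ArithmeticalFun.quint, ArithmeticalFun.var, ArithmeticalFun.const]
  obtain ⟨D, hD, hDT⟩ := exists_isPredicate hT
  refine ⟨D.inst (numeral D.code), ?_, fun v => ?_⟩
  · refine Formula.Below.subst (m := 1) (fun i hi => ?_) hD
    obtain rfl : i = 0 := by omega
    exact below_numeral 0 _
  · rw [holds_inst, val_numeral, hDT]
    constructor
    · rintro ⟨c, b, hc, hb, h⟩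
      obtain ⟨n, hn⟩ := isNumeralPair_iff.1 hc
      obtain ⟨rfl, rfl⟩ := Nat.pair_eq_pair.1 hn
      obtain ⟨t, A, ht, hA, rfl⟩ := hb.exists
      obtain rfl := formula_code_injective hA
      obtain rfl := term_code_injective ht
      rwa [inst_eq]
    · intro h
      refine ⟨_, _, isNumeralPair_iff.2 ⟨_, rfl⟩, substCode_code D _ 0, ?_⟩
      rwa [← inst_eq]

/-- Gödel's first incompleteness theorem for number theory. -/
theorem not_complete_numberTheory : ¬ numberTheory.Complete := by
  intro hc
  obtain ⟨A, hA, h⟩ := exists_diagonal_sentence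
    (S := IsTheoremCode) (Arithmetical.isTheoremCode (.var 0))
  have hne : ¬ IsTheoremCode A.code := fun ht => (h 0).1 (holds_of_isTheoremCode ht 0) ht
  rcases hc A hA with hp | hp
  · exact hne (isTheoremCode_of_proves hp)
  · exact holds_of_isTheoremCode (isTheoremCode_of_proves hp) 0 ((h 0).2 hne)

end Arith

theorem mainTheorem2 :
    ¬ (numberTheory.GoedelAssumption ∧ numberTheory.DecidesSentences) := by
  rintro ⟨-, -, hc⟩
  exact Arith.not_complete_numberTheory hc
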